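/- Let $\tau$ be a preorder (a reflexive and transitive relation $\le$) on a nonempty finite set $E$. Its vertices are the classes of the equivalence relation "$a \le b$ and $b \le a$" on $E$; for a vertex $v$, let $|v|$ be its number of elements and let $\mathrm{up}(v) \subseteq E$ be the principal order filter generated by $v$, i.e. the set of $e \in E$ with $a \le e$ for some (equivalently, every) $a \in v$. An order ideal of $\tau$ is a (possibly empty) subset $I \subseteq E$ such that $a \le b$ and $b \in I$ imply $a \in I$. Let $E \sqcup \{0\}$ be $E$ with one additional element $0$. For $I \subseteq E$, let $\bar\Delta_I \subset \mathbb{R}^E$ be the convex hull of the zero vector and the standard basis vectors $\mathbf{e}_e$, $e \in I$; for a nonempty subset $I$ of a finite set $F$, let $\Delta_I \subset \mathbb{R}^{F}$ be the convex hull of the standard basis vectors indexed by $I$. Sums of sets are Minkowski sums, and $S^{k}$ denotes the $k$-th Minkowski power $S + \cdots + S$ ($k$ summands). For integers $r, s \ge 0$ put $$Q_\tau(r,s) = r \sum_{v} (\bar\Delta_{\mathrm{up}(v)})^{|v|} + s\, \bar\Delta_E \subset \mathbb{R}^E,$$ where the sum ranges over all vertices $v$ of $\tau$. Let $Q_\tau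 \subset \mathbb{R}^E$ be the preorder polytope, defined by $x_e \ge 0$ for all $e \in E$ and $\sum_{e \in I} x_e \le |I|$ for all order ideals $I$ of $\tau$. A Y-type generalized permutohedron in $\mathbb{R}^F$, for a nonempty finite set $F$, is a Minkowski sum $\sum_{\varnothing \ne I \subseteq F} y_I \Delta_I$ with real numbers $y_I \ge 0$. Two polytopes $P \subset \mathbb{R}^F$ and $P' \subset \mathbb{R}^{F'}$ are unimodularly equivalent if some affine map $\mathbb{R}^F \to \mathbb{R}^{F'}$ maps $P$ onto $P'$ and restricts to a bijection from the affine span of $P$ onto that of $P'$ which maps the set of integer points of the former onto the set of integer points of the latter. Then, for all integers $r, s \ge 0$: 1. $Q_\tau(r,s)$ is unimodularly equivalent to the polytope $$r \sum_{v} (\Delta_{\mathrm{up}(v) \sqcup \{0\}})^{|v|} + s\, \Delta_{E \sqcup \{0\}} \subset \mathbb{R}^{E \sqcup \{0\}},$$ and the latter is a Y-type generalized permutohedron. 2. $Q_\tau(r,s)$ is the set of all $x \in \mathbb{R}^E$ with $x_e \ge 0$ for every $e \in E$ and $\sum_{e \in I} x_e \le r|I| + s$ for every order ideal $I$ of $\tau$.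 In particular, $Q_\tau(1,0) = Q_\tau$. -/

import Mathlib

open scoped Pointwise

namespace PreorderPolytope

/-! ### Lattice points and unimodular equivalence -/

/-- The integer lattice `ℤ^ι` inside `ℝ^ι`. -/
def integerLattice (ι : Type*) : Set (ι → ℝ) :=
  {x | ∀ i, ∃ n : ℤ, x i = (n : ℝ)}

/-- `P ⊆ ℝ^ι` and `Q ⊆ ℝ^κ` are unimodularly equivalent: there is an affine map which restricts to
a bijection from the affine span of `P` onto the affine span of `Q`, maps the lattice points of the
first span exactly onto the lattice points of the second one, and maps `P` onto `Q`. -/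
def UnimodularlyEquivalent {ι κ : Type*} (P : Set (ι → ℝ)) (Q : Set (κ → ℝ)) : Prop :=
  ∃ f : (ι → ℝ) →ᵃ[ℝ] (κ → ℝ),
    Set.BijOn f (affineSpan ℝ P : Set (ι → ℝ)) (affineSpan ℝ Q : Set (κ → ℝ)) ∧
    f '' ((affineSpan ℝ P : Set (ι → ℝ)) ∩ integerLattice ι) =
      (affineSpan ℝ Q : Set (κ → ℝ)) ∩ integerLattice κ ∧
    f '' P = Q

/-! ### Simplices, Minkowski powers, Y-type generalized permutohedra -/

/-- The standard simplex `Δ_I`: the convex hull of the basis vectors `e_i`, `i ∈ I`. -/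
def simplex {ι : Type*} [DecidableEq ι] (I : Set ι) : Set (ι → ℝ) :=
  convexHull ℝ ((fun i => Pi.single i (1 : ℝ)) '' I)

/-- The simplex `Δ̄_I`: the convex hull of the zero vector and the basis vectors `e_i`, `i ∈ I`. -/
def barSimplex {ι : Type*} [DecidableEq ι] (I : Set ι) : Set (ι → ℝ) :=
  convexHull ℝ (insert 0 ((fun i => Pi.single i (1 : ℝ)) '' I))

/-- The `k`-th Minkowski power `S + S + ⋯ + S` (`k` summands). -/
def minkowskiPower {ι : Type*} (k : ℕ) (S : Set (ι → ℝ)) : Set (ι → ℝ) :=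
  ∑ _j ∈ Finset.range k, S

/-- The Minkowski sum `P^y(y) = ∑_{∅ ≠ I ⊆ ι} y_I Δ_I`. The value `y ∅` is not used. -/
def yPermutohedron {ι : Type*} [Fintype ι] [DecidableEq ι] (y : Finset ι → ℝ) : Set (ι → ℝ) :=
  ∑ I ∈ Finset.univ.filter (fun I : Finset ι => I.Nonempty), y I • simplex (I : Set ι)

/-- `P` is a Y-type generalized permutohedron: `P = P^y(y)` for nonnegative reals `y_I`. -/
def IsYTypeGeneralizedPermutohedron {ι : Type*} [Fintype ι] [DecidableEq ι]
    (P : Set (ι → ℝ)) : Prop :=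
  ∃ y : Finset ι → ℝ, (∀ I : Finset ι, I.Nonempty → 0 ≤ y I) ∧ P = yPermutohedron y

/-! ### Preorders and their polytopes -/

/-- The vertices of a preorder: the classes of the relation `a ≤ b ∧ b ≤ a`, with the induced
partial order. -/
abbrev Vertex (E : Type*) [Preorder E] : Type _ := Antisymmetrization E (· ≤ ·)

noncomputable instance (E : Type*) [Preorder E] [Finite E] : Fintype (Vertex E) :=
  @Fintype.ofFinite _ (Quotient.finite _)

/-- The set of elements of `E` which belong to the vertex `v`. -/
def Vertex.block {E : Type*} [Preorder E] (v : Vertex E) : Set E :=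
  {e | toAntisymmetrization (· ≤ ·) e = v}

/-- The size `|v|` of a vertex `v`. -/
noncomputable def Vertex.size {E : Type*} [Preorder E] (v : Vertex E) : ℕ := v.block.ncard

/-- The principal order filter `up(v) ⊆ E` generated by the vertex `v`. -/
def Vertex.up {E : Type*} [Preorder E] (v : Vertex E) : Set E :=
  {e | v ≤ toAntisymmetrization (· ≤ ·) e}

/-- The polytope `Q_τ(r,s) = r ∑_v (Δ̄_{up(v)})^{|v|} + s Δ̄_E` in `ℝ^E`. -/
def rsPolytope (E : Type*) [Fintype E] [DecidableEq E] [Preorder E] (r s : ℕ) : Set (E → ℝ) :=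
  (r : ℝ) • (∑ v : Vertex E, minkowskiPower v.size (barSimplex v.up)) +
    (s : ℝ) • barSimplex (Set.univ : Set E)

/-- The Minkowski sum `r ∑_v (Δ_{up(v) ⊔ {0}})^{|v|} + s Δ_{E ⊔ {0}}` in `ℝ^{E ⊔ {0}}`. Here
`E ⊔ {0}` is `Option E`, with `none` as the additional element `0`. -/
def homogenizedPolytope (E : Type*) [Fintype E] [DecidableEq E] [Preorder E] (r s : ℕ) :
    Set (Option E → ℝ) :=
  (r : ℝ) • (∑ v : Vertex E, minkowskiPower v.size (simplex (insert none (some '' v.up)))) +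
    (s : ℝ) • simplex (Set.univ : Set (Option E))

/-- The preorder polytope `Q_τ`: `x_e ≥ 0` for `e ∈ E` and `∑_{e ∈ I} x_e ≤ |I|` for every order
ideal `I`, i.e. for every subset `I` of `E` which is closed downwards. -/
def preorderPolytope (E : Type*) [Fintype E] [Preorder E] : Set (E → ℝ) :=
  {x | (∀ e, 0 ≤ x e) ∧
    ∀ I : Finset E, IsLowerSet (I : Set E) → ∑ e ∈ I, x e ≤ (I.card : ℝ)}

end PreorderPolytope

namespace PreorderPolytope

/-! Homogenization: appending the coordinate `-∑ x_e` embeds `ℝ^E` linearly in `ℝ^{E ⊔ {0}}`, and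
each `Δ_{I ⊔ {0}}` is the image of `Δ̄_I` translated by `e_0`. Translations add up, so the two
Minkowski sums differ by an injective affine map that preserves and reflects integrality.
Inequalities: for an ideal `I`, the copy of `Δ̄_{up(a)}` attached to `a ∈ E` adds at most `1` to
`∑_{e ∈ I} x_e`, and `0` unless `a ∈ I`. Conversely, separate a point `x` outside the polytope by a
functional `f`. The maximum `d a` of `f` on `Δ̄_{up(a)}` is nonnegative, antitone in `a` and at most
the maximum `M` on `Δ̄_E`. Decomposing `d` into ideal indicators (`sum_antitone_mul_le`) gives `f x
≤ ∑ d e * x e ≤ r ∑ d e + s M`, and the right side is attained by `f` on the polytope, a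
contradiction. -/

open Finset in
/-- Abel summation for an antitone weight: bounds on lower sets bound every antitone functional. -/
theorem sum_antitone_mul_le {E : Type*} [Fintype E] [Preorder E] {x : E → ℝ} {r s : ℝ}
    (hx : ∀ I : Finset E, IsLowerSet (I : Set E) → ∑ e ∈ I, x e ≤ r * (#I : ℝ) + s)
    (d : E → ℝ) (M : ℝ) (hd : Antitone d) (h0 : ∀ e, 0 ≤ d e) (hM : ∀ e, d e ≤ M)
    (hM0 : 0 ≤ M) : ∑ e, d e * x e ≤ r * ∑ e, d e + s * M := by
  classical
  have hs : 0 ≤ s := by simpa using hx ∅ (by simpa using isLowerSet_empty)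
  induction hn : #{e | d e ≠ 0} using Nat.strong_induction_on generalizing d M with
  | _ n ih =>
    set I : Finset E := {e | d e ≠ 0} with hI
    have hmem : ∀ e, e ∈ I ↔ d e ≠ 0 := by simp [hI]
    rcases I.eq_empty_or_nonempty with h | h
    · have hz : ∀ e, d e = 0 := fun e => by
        by_contra hne
        simpa [h] using (hmem e).2 hne
      simp only [hz, zero_mul, sum_const_zero, mul_zero, zero_add]
      positivity
    · obtain ⟨a, ha, hmin⟩ := exists_min_image I d h
      have hlow : IsLowerSet (I : Set E) := by
        intro b c hcb hb
        rw [mem_coe, hmem] at *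
        exact (lt_of_lt_of_le (lt_of_le_of_ne (h0 b) hb.symm) (hd hcb)).ne'
      -- The support `I` is an ideal because `d` is antitone. Removing the layer `d a * 1_I`, with
      -- `d a` the least value on `I`, kills `a`, so the support shrinks, and lowers the bound `M`
      -- by `d a`.
      set d' : E → ℝ := fun e => if e ∈ I then d e - d a else 0 with hd'
      have key := ih #{e | d' e ≠ 0} ?_ d' (M - d a) ?_ ?_ ?_ ?_ rfl
      · have hdec : ∀ e, d e = d' e + if e ∈ I then d a else 0 := by
          intro e
          by_cases he : e ∈ I
          · simp [hd', he]
          · simpa [hd', he] using not_not.1 (mt (hmem e).2 he)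
        have h1 : ∑ e, d e * x e = ∑ e, d' e * x e + d a * ∑ e ∈ I, x e := by
          rw [mul_sum, ← univ_inter I, ← sum_ite_mem, ← sum_add_distrib]
          refine sum_congr rfl fun e _ => ?_
          nth_rw 1 [hdec e]
          split_ifs <;> ring
        have h2 : ∑ e, d e = ∑ e, d' e + d a * #I := by
          rw [mul_comm, ← nsmul_eq_mul, ← sum_const, ← univ_inter I, ← sum_ite_mem,
            ← sum_add_distrib]
          exact sum_congr rfl fun e _ => hdec e
        have h3 := mul_le_mul_of_nonneg_left (hx I hlow) (h0 a)
        rw [h1, h2]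
        linarith
      · rw [← hn]
        refine card_lt_card (ssubset_iff_of_subset ?_ |>.2 ⟨a, ha, by simp [hd']⟩)
        intro e he
        by_contra hne
        simp [hd', hne] at he
      · intro b c hbc
        by_cases hc : c ∈ I
        · have hb : b ∈ I := hlow hbc hc
          simpa [hd', hb, hc] using hd hbc
        · by_cases hb : b ∈ I
          · simpa [hd', hb, hc] using hmin b hb
          · simp [hd', hb, hc]
      · intro e
        by_cases he : e ∈ I
        · simpa [hd', he] using hmin e he
        · simp [hd', he]
      · intro e
        by_cases he : e ∈ I
        · simpa [hd', he] using hM e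
        · simpa [hd', he] using hM a
      · simpa using hM a

/-! ### Simplices and their Minkowski powers -/

theorem convex_simplex {ι : Type*} [DecidableEq ι] (I : Set ι) : Convex ℝ (simplex I) :=
  convex_convexHull ℝ _

theorem convex_barSimplex {ι : Type*} [DecidableEq ι] (I : Set ι) : Convex ℝ (barSimplex I) :=
  convex_convexHull ℝ _

theorem nonempty_simplex {ι : Type*} [DecidableEq ι] {I : Set ι} (hI : I.Nonempty) :
    (simplex I).Nonempty :=
  (hI.image _).convexHull

theorem zero_mem_barSimplex {ι : Type*} [DecidableEq ι] (I : Set ι) : (0 : ι → ℝ) ∈ barSimplex I :=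
  subset_convexHull ℝ _ (Set.mem_insert _ _)

theorem single_mem_barSimplex {ι : Type*} [DecidableEq ι] {I : Set ι} {e : ι} (he : e ∈ I) :
    (Pi.single e 1 : ι → ℝ) ∈ barSimplex I :=
  subset_convexHull ℝ _ (Set.mem_insert_of_mem _ ⟨e, he, rfl⟩)

theorem barSimplex_mono {ι : Type*} [DecidableEq ι] {I J : Set ι} (h : I ⊆ J) :
    barSimplex I ⊆ barSimplex J :=
  convexHull_mono (Set.insert_subset_insert (Set.image_mono h))

theorem isCompact_barSimplex {ι : Type*} [Finite ι] [DecidableEq ι] (I : Set ι) :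
    IsCompact (barSimplex I) :=
  (((Set.toFinite I).image _).insert _).isCompact_convexHull ℝ

theorem nonneg_of_mem_barSimplex {ι : Type*} [DecidableEq ι] {I : Set ι} {x : ι → ℝ}
    (hx : x ∈ barSimplex I) (e : ι) : 0 ≤ x e := by
  have hc : Convex ℝ {x : ι → ℝ | 0 ≤ x e} :=
    convex_halfSpace_ge (LinearMap.isLinear (LinearMap.proj (R := ℝ) (φ := fun _ : ι => ℝ) e)) 0
  refine convexHull_min ?_ hc hx
  rintro _ (rfl | ⟨i, -, rfl⟩)
  · simp
  · by_cases h : e = i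
    · subst h; simp
    · simp [h]

/-- The coordinates indexed by `J` of a point of `Δ̄_I` sum to at most `1`, and vanish if `I` and
`J` are disjoint. -/
theorem sum_le_of_mem_barSimplex {ι : Type*} [DecidableEq ι] {I : Set ι} {x : ι → ℝ}
    (hx : x ∈ barSimplex I) (J : Finset ι) {c : ℝ} (hc0 : 0 ≤ c)
    (hc : ∀ i ∈ I, i ∈ J → 1 ≤ c) : ∑ e ∈ J, x e ≤ c := by
  have hconv : Convex ℝ {x : ι → ℝ | ∑ e ∈ J, x e ≤ c} := by
    have h := convex_halfSpace_le
      (LinearMap.isLinear (∑ e ∈ J, LinearMap.proj (R := ℝ) (φ := fun _ : ι => ℝ) e)) c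
    simpa using h
  refine convexHull_min ?_ hconv hx
  rintro _ (rfl | ⟨i, hi, rfl⟩)
  · simpa using hc0
  · change ∑ e ∈ J, (Pi.single i 1 : ι → ℝ) e ≤ c
    rw [Finset.sum_pi_single']
    split_ifs with h
    exacts [hc i hi h, hc0]

/-- Minkowski powers of convex sets are dilates. -/
theorem minkowskiPower_eq_smul {ι : Type*} {S : Set (ι → ℝ)} (hS : Convex ℝ S)
    (hne : S.Nonempty) (k : ℕ) : minkowskiPower k S = (k : ℝ) • S := by
  induction k with
  | zero => simp [minkowskiPower, Set.zero_smul_set hne]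
  | succ k ih =>
    rw [minkowskiPower, Finset.sum_range_succ, ← minkowskiPower, ih, Nat.cast_succ,
      hS.add_smul (by positivity) zero_le_one, one_smul]

theorem rsPolytope_eq (E : Type*) [Fintype E] [DecidableEq E] [Preorder E] (r s : ℕ) :
    rsPolytope E r s = (r : ℝ) • (∑ v : Vertex E, (v.size : ℝ) • barSimplex v.up) +
      (s : ℝ) • barSimplex (Set.univ : Set E) := by
  simp_rw [rsPolytope,
    fun v : Vertex E => minkowskiPower_eq_smul (convex_barSimplex v.up) ⟨0, zero_mem_barSimplex _⟩]

theorem homogenizedPolytope_eq (E : Type*) [Fintype E] [DecidableEq E] [Preorder E] (r s : ℕ) :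
    homogenizedPolytope E r s =
      (r : ℝ) • (∑ v : Vertex E, (v.size : ℝ) • simplex (insert none (some '' v.up))) +
      (s : ℝ) • simplex (Set.univ : Set (Option E)) := by
  simp_rw [homogenizedPolytope, fun v : Vertex E =>
    minkowskiPower_eq_smul (convex_simplex (insert none (some '' v.up)))
      (nonempty_simplex (Set.insert_nonempty _ _))]

/-! ### Y-type generalized permutohedra -/

section YType

variable {ι : Type*} [Fintype ι] [DecidableEq ι]

theorem IsYTypeGeneralizedPermutohedron.zero :
    IsYTypeGeneralizedPermutohedron (0 : Set (ι → ℝ)) := by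
  refine ⟨0, fun _ _ => le_rfl, ?_⟩
  rw [yPermutohedron]
  refine (Finset.sum_eq_zero fun I hI => ?_).symm
  exact Set.zero_smul_set (nonempty_simplex (by simpa using hI))

/-- Convexity gives `(y + z) • Δ_I = y • Δ_I + z • Δ_I` for nonnegative coefficients, so coefficient
vectors add. -/
theorem IsYTypeGeneralizedPermutohedron.add {P Q : Set (ι → ℝ)}
    (hP : IsYTypeGeneralizedPermutohedron P) (hQ : IsYTypeGeneralizedPermutohedron Q) :
    IsYTypeGeneralizedPermutohedron (P + Q) := by
  obtain ⟨y, hy, rfl⟩ := hP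
  obtain ⟨z, hz, rfl⟩ := hQ
  refine ⟨y + z, fun I hI => add_nonneg (hy I hI) (hz I hI), ?_⟩
  simp only [yPermutohedron, ← Finset.sum_add_distrib]
  refine Finset.sum_congr rfl fun I hI => ?_
  have hI' : I.Nonempty := by simpa using hI
  exact ((convex_simplex _).add_smul (hy I hI') (hz I hI')).symm

theorem IsYTypeGeneralizedPermutohedron.smul {P : Set (ι → ℝ)}
    (hP : IsYTypeGeneralizedPermutohedron P) {c : ℝ} (hc : 0 ≤ c) :
    IsYTypeGeneralizedPermutohedron (c • P) := by
  obtain ⟨y, hy, rfl⟩ := hP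
  refine ⟨c • y, fun I hI => mul_nonneg hc (hy I hI), ?_⟩
  simp only [yPermutohedron, Finset.smul_sum, Pi.smul_apply, smul_assoc]

theorem IsYTypeGeneralizedPermutohedron.sum {κ : Type*} (t : Finset κ) {P : κ → Set (ι → ℝ)}
    (hP : ∀ k ∈ t, IsYTypeGeneralizedPermutohedron (P k)) :
    IsYTypeGeneralizedPermutohedron (∑ k ∈ t, P k) :=
  Finset.sum_induction _ _ (fun _ _ => .add) .zero hP

theorem isYTypeGeneralizedPermutohedron_simplex {I : Set ι} (hI : I.Nonempty) :
    IsYTypeGeneralizedPermutohedron (simplex I) := by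
  classical
  lift I to Finset ι using Set.toFinite I
  refine ⟨Pi.single I 1, fun J _ => ?_, ?_⟩
  · by_cases h : J = I
    · subst h; simp
    · simp [h]
  · rw [yPermutohedron, Finset.sum_eq_single I]
    · simp
    · intro J hJ hne
      rw [Pi.single_eq_of_ne hne]
      exact Set.zero_smul_set (nonempty_simplex (by simpa using hJ))
    · intro h
      exact absurd (by simpa using hI) h

end YType

theorem isYTypeGeneralizedPermutohedron_homogenizedPolytope (E : Type*) [Fintype E]
    [DecidableEq E] [Preorder E] (r s : ℕ) :
    IsYTypeGeneralizedPermutohedron (homogenizedPolytope E r s) := by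
  rw [homogenizedPolytope_eq]
  refine .add (.smul (.sum _ fun v _ => .smul ?_ (by positivity)) (by positivity))
    (.smul ?_ (by positivity))
  · exact isYTypeGeneralizedPermutohedron_simplex (Set.insert_nonempty _ _)
  · exact isYTypeGeneralizedPermutohedron_simplex Set.univ_nonempty

/-! ### Homogenization -/

/-- The linear embedding `ℝ^E → ℝ^{E ⊔ {0}}` onto the vectors with coordinate sum `0`. -/
def homogenize (E : Type*) [Fintype E] : (E → ℝ) →ₗ[ℝ] (Option E → ℝ) where
  toFun x i := i.elim (-∑ e, x e) x
  map_add' x y := by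
    ext (_ | e)
    · simp [Finset.sum_add_distrib, add_comm]
    · simp
  map_smul' c x := by
    ext (_ | e)
    · simp [Finset.mul_sum]
    · simp

section Homogenize

variable {E : Type*} [Fintype E]

@[simp] theorem homogenize_none (x : E → ℝ) : homogenize E x none = -∑ e, x e := rfl

@[simp] theorem homogenize_some (x : E → ℝ) (e : E) : homogenize E x (some e) = x e := rfl

theorem homogenize_injective : Function.Injective (homogenize E) := fun x y h =>
  funext fun e => by simpa using congrFun h (some e)

variable [DecidableEq E]

/-- Before the translation by `e_0`, the vertices `0` and `e_i` go to `0` and `e_i - e_0`;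
afterwards they are `e_0` and `e_i`. -/
theorem simplex_insert_none (I : Set E) :
    simplex (insert none (some '' I)) =
      homogenize E '' barSimplex I + {Pi.single none (1 : ℝ)} := by
  rw [Set.add_singleton, barSimplex, (homogenize E).image_convexHull, simplex]
  have := (AffineEquiv.constVAdd ℝ (Option E → ℝ) (Pi.single none 1)).toAffineMap.image_convexHull
    (homogenize E '' insert 0 ((fun i => Pi.single i (1 : ℝ)) '' I))
  have hf : ⇑(AffineEquiv.constVAdd ℝ (Option E → ℝ) (Pi.single none 1)).toAffineMap =
      fun x => x + Pi.single none 1 := by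
    ext x : 1
    simp [add_comm]
  rw [hf] at this
  rw [this]
  congr 1
  rw [Set.image_insert_eq, Set.image_insert_eq, Set.image_insert_eq, map_zero, zero_add,
    Set.image_image, Set.image_image, Set.image_image]
  congr 1
  refine Set.image_congr fun e _ => ?_
  ext (_ | a)
  · simp
  · simp [Pi.single_apply]

end Homogenize

/-- Trades multiplicities `|v|` for a sum over elements; with constant `D` it shows that the sizes
add up to `|E|`. -/
theorem sum_size_smul {E : Type*} [Fintype E] [Preorder E] {V : Type*} [AddCommMonoid V] [Module ℝ V] (D : Vertex E → V) :
    ∑ v : Vertex E, (v.size : ℝ) • D v = ∑ a : E, D (toAntisymmetrization (· ≤ ·) a) := by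
  classical
  rw [← Finset.sum_fiberwise Finset.univ (fun a : E => toAntisymmetrization (· ≤ ·) a)]
  refine Finset.sum_congr rfl fun v _ => ?_
  rw [Finset.sum_congr rfl (g := fun _ => D v)
    (fun a ha => by rw [(Finset.mem_filter.1 ha).2]), Finset.sum_const, Vertex.size,
    Nat.cast_smul_eq_nsmul, Set.ncard_eq_toFinset_card']
  congr 2
  ext a
  rw [Set.mem_toFinset]
  simp [Vertex.block]

variable {E : Type*} [Fintype E] [DecidableEq E] [Preorder E]

theorem homogenizedPolytope_eq_image (r s : ℕ) :
    homogenizedPolytope E r s = (fun x => homogenize E x +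
      Pi.single none ((r : ℝ) * Fintype.card E + s)) '' rsPolytope E r s := by
  have hu : (Set.univ : Set (Option E)) = insert none (some '' Set.univ) := by
    ext (_ | a) <;> simp
  have hs := sum_size_smul (E := E) (fun _ => (Pi.single none (1 : ℝ) : Option E → ℝ))
  set t : Option E → ℝ := Pi.single none ((r : ℝ) * Fintype.card E + s) with ht
  rw [homogenizedPolytope_eq, rsPolytope_eq, hu,
    ← Set.image_image (· + t) (homogenize E),
    Set.image_add, image_smul_set, Set.image_finsetSum]
  simp_rw [image_smul_set, simplex_insert_none, smul_add, Set.smul_set_singleton,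
    Finset.sum_add_distrib, Set.finsetSum_singleton, smul_add, Set.smul_set_singleton, hs]
  rw [add_add_add_comm, Set.singleton_add_singleton, Set.add_singleton]
  congr! 3
  ext (_ | a) <;> simp [ht]

theorem unimodularlyEquivalent_homogenizedPolytope (r s : ℕ) :
    UnimodularlyEquivalent (rsPolytope E r s) (homogenizedPolytope E r s) := by
  set N : ℝ := (r : ℝ) * Fintype.card E + s with hN
  let f : (E → ℝ) →ᵃ[ℝ] (Option E → ℝ) :=
    (homogenize E).toAffineMap + AffineMap.const ℝ (E → ℝ) (Pi.single none N : Option E → ℝ)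
  have hf : ⇑f = fun x => homogenize E x + Pi.single none N := rfl
  have himg : f '' rsPolytope E r s = homogenizedPolytope E r s := by
    rw [homogenizedPolytope_eq_image, hf]
  have hinj : Function.Injective f := fun x y h => homogenize_injective (by simpa [hf] using h)
  have hspan : f '' (affineSpan ℝ (rsPolytope E r s)) =
      affineSpan ℝ (homogenizedPolytope E r s) := by
    rw [← himg, ← AffineSubspace.map_span, AffineSubspace.coe_map]
  have hint : ∀ x, f x ∈ integerLattice (Option E) ↔ x ∈ integerLattice E := by
    intro x
    constructor
    · intro h e
      simpa [hf] using h (some e)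
    · intro h
      choose n hn using h
      rintro (_ | e)
      -- The extra coordinate is `-∑ x_e + r|E| + s`, an integer whenever all `x_e` are.
      · exact ⟨-∑ e, n e + (r * Fintype.card E + s), by simp [hf, hn, hN]⟩
      · exact ⟨n e, by simp [hf, hn]⟩
  refine ⟨f, hspan ▸ hinj.injOn.bijOn_image, ?_, himg⟩
  have hpre : integerLattice E = f ⁻¹' integerLattice (Option E) := Set.ext fun x => (hint x).symm
  rw [hpre, Set.image_inter_preimage, hspan]

/-! ### The inequality description -/

theorem exists_forall_le_of_mem_barSimplex {ι : Type*} [Finite ι] [DecidableEq ι]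
    (f : StrongDual ℝ (ι → ℝ)) (I : Set ι) :
    ∃ p ∈ barSimplex I, ∀ q ∈ barSimplex I, f q ≤ f p :=
  (isCompact_barSimplex I).exists_isMaxOn ⟨0, zero_mem_barSimplex I⟩ f.continuous.continuousOn

theorem Vertex.up_anti {E : Type*} [Preorder E] {v w : Vertex E} (h : v ≤ w) : w.up ⊆ v.up :=
  fun _ he => h.trans he

theorem convex_rsPolytope (r s : ℕ) : Convex ℝ (rsPolytope E r s) := by
  rw [rsPolytope_eq]
  exact ((convex_sum _ fun v _ => (convex_barSimplex _).smul _).smul _).add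
    ((convex_barSimplex _).smul _)

theorem isCompact_rsPolytope (r s : ℕ) : IsCompact (rsPolytope E r s) := by
  rw [rsPolytope_eq]
  refine IsCompact.add (.smul _ (Finset.sum_induction _ IsCompact (fun _ _ => .add)
    isCompact_singleton fun v _ => ?_)) (.smul _ (isCompact_barSimplex _))
  exact (isCompact_barSimplex _).smul _

/-- By convexity the `|v|` summands of a vertex `v` can share one point `p v`. -/
theorem mem_rsPolytope_iff (r s : ℕ) {x : E → ℝ} :
    x ∈ rsPolytope E r s ↔ ∃ (p : Vertex E → E → ℝ) (q : E → ℝ),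
      (∀ v, p v ∈ barSimplex v.up) ∧ q ∈ barSimplex Set.univ ∧
      (r : ℝ) • ∑ a : E, p (toAntisymmetrization (· ≤ ·) a) + (s : ℝ) • q = x := by
  simp_rw [rsPolytope_eq, ← sum_size_smul]
  constructor
  · rintro ⟨_, ⟨z, hz, rfl⟩, _, ⟨q, hq, rfl⟩, rfl⟩
    obtain ⟨g, hg, rfl⟩ := (Set.mem_fintype_sum _ _).1 hz
    choose p hp hpg using hg
    exact ⟨p, q, hp, hq, by simp [hpg]⟩
  · rintro ⟨p, q, hp, hq, rfl⟩
    exact Set.add_mem_add (Set.smul_mem_smul_set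
      (Set.finsetSum_mem_finsetSum _ _ _ fun v _ => Set.smul_mem_smul_set (hp v)))
      (Set.smul_mem_smul_set hq)

theorem sum_le_of_mem_rsPolytope {r s : ℕ} {x : E → ℝ} (hx : x ∈ rsPolytope E r s)
    (I : Finset E) (hI : IsLowerSet (I : Set E)) :
    ∑ e ∈ I, x e ≤ (r : ℝ) * (I.card : ℝ) + (s : ℝ) := by
  obtain ⟨p, q, hp, hq, rfl⟩ := (mem_rsPolytope_iff r s).1 hx
  have h1 : ∀ a : E, ∑ e ∈ I, p (toAntisymmetrization (· ≤ ·) a) e ≤ if a ∈ I then 1 else 0 := by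
    intro a
    refine sum_le_of_mem_barSimplex (hp _) I (by split_ifs <;> simp) fun i hi hiI => ?_
    -- If `up(a)` meets the ideal `I` in `i`, then `a ≤ i` forces `a ∈ I`.
    have hai : a ≤ i := toAntisymmetrization_le_toAntisymmetrization_iff.1 hi
    rw [if_pos (Finset.mem_coe.1 (hI hai (Finset.mem_coe.2 hiI)))]
  have h2 : ∑ e ∈ I, q e ≤ 1 := sum_le_of_mem_barSimplex hq I zero_le_one fun _ _ _ => le_rfl
  have h3 := Finset.sum_le_sum fun a (_ : a ∈ Finset.univ) => h1 a
  rw [Finset.sum_ite_mem, Finset.univ_inter, Finset.sum_const, nsmul_eq_mul, mul_one,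
    Finset.sum_comm] at h3
  simp only [Pi.add_apply, Pi.smul_apply, Finset.sum_apply, smul_eq_mul, Finset.sum_add_distrib,
    ← Finset.mul_sum]
  have hr : (0 : ℝ) ≤ r := by positivity
  have hs : (0 : ℝ) ≤ s := by positivity
  nlinarith [mul_le_mul_of_nonneg_left h3 hr, mul_le_mul_of_nonneg_left h2 hs]

theorem mem_rsPolytope_of_forall_sum_le {r s : ℕ} {x : E → ℝ} (h0 : ∀ e, 0 ≤ x e)
    (hx : ∀ I : Finset E, IsLowerSet (I : Set E) →
      ∑ e ∈ I, x e ≤ (r : ℝ) * (I.card : ℝ) + (s : ℝ)) : x ∈ rsPolytope E r s := by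
  by_contra hmem
  obtain ⟨f, u, hlt, hu⟩ := geometric_hahn_banach_closed_point (convex_rsPolytope r s)
    (isCompact_rsPolytope r s).isClosed hmem
  choose p hp hmax using fun v : Vertex E => exists_forall_le_of_mem_barSimplex f v.up
  obtain ⟨q, hq, hqmax⟩ := exists_forall_le_of_mem_barSimplex f (Set.univ : Set E)
  -- Explicitly, `d a` is the maximum of `0` and the values `f e_i` for `i ≥ a`.
  set d : E → ℝ := fun a => f (p (toAntisymmetrization (· ≤ ·) a)) with hd
  have hbound := sum_antitone_mul_le hx d (f q) ?_ ?_ ?_ ?_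
  · have hpq := hlt _ ((mem_rsPolytope_iff r s).2 ⟨p, q, hp, hq, rfl⟩)
    -- Since `e ∈ up(e)`, `f e_e ≤ d e`; multiply by `x e ≥ 0`.
    have hfx : f x ≤ ∑ e, d e * x e := by
      conv_lhs => rw [pi_eq_sum_univ' x, map_sum]
      refine Finset.sum_le_sum fun e _ => ?_
      rw [map_smul, smul_eq_mul, mul_comm]
      refine mul_le_mul_of_nonneg_right (hmax _ _ ?_) (h0 e)
      have h := single_mem_barSimplex
        (I := Vertex.up (toAntisymmetrization (· ≤ ·) e)) (e := e) le_rfl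
      convert h using 1
    rw [map_add, map_smul, map_smul, map_sum, smul_eq_mul, smul_eq_mul] at hpq
    linarith
  · exact fun a b hab => hmax _ _ (barSimplex_mono (Vertex.up_anti
      (toAntisymmetrization_le_toAntisymmetrization_iff.2 hab)) (hp _))
  · exact fun e => by simpa using hmax _ 0 (zero_mem_barSimplex _)
  · exact fun e => hqmax _ (barSimplex_mono (Set.subset_univ _) (hp _))
  · simpa using hqmax 0 (zero_mem_barSimplex _)

theorem nonneg_of_mem_rsPolytope {r s : ℕ} {x : E → ℝ} (hx : x ∈ rsPolytope E r s) (e : E) :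
    0 ≤ x e := by
  obtain ⟨p, q, hp, hq, rfl⟩ := (mem_rsPolytope_iff r s).1 hx
  simp only [Pi.add_apply, Pi.smul_apply, Finset.sum_apply, smul_eq_mul]
  have h1 := Finset.sum_nonneg fun (a : E) (_ : a ∈ Finset.univ) =>
    nonneg_of_mem_barSimplex (hp (toAntisymmetrization (· ≤ ·) a)) e
  have h2 := nonneg_of_mem_barSimplex hq e
  positivity

theorem rsPolytope_eq_setOf (r s : ℕ) :
    rsPolytope E r s = {x : E → ℝ | (∀ e, 0 ≤ x e) ∧
      ∀ I : Finset E, IsLowerSet (I : Set E) →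
        ∑ e ∈ I, x e ≤ (r : ℝ) * (I.card : ℝ) + (s : ℝ)} :=
  Set.ext fun _ => ⟨fun hx => ⟨nonneg_of_mem_rsPolytope hx, sum_le_of_mem_rsPolytope hx⟩,
    fun hx => mem_rsPolytope_of_forall_sum_le hx.1 hx.2⟩

theorem rsPolytope_one_zero : rsPolytope E 1 0 = preorderPolytope E := by
  simp [rsPolytope_eq_setOf, preorderPolytope]

end PreorderPolytope

theorem proposition3p2 (E : Type*) [Fintype E] [DecidableEq E] [Nonempty E] [Preorder E] :
    (∀ r s : ℕ,
      PreorderPolytope.UnimodularlyEquivalent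
        (PreorderPolytope.rsPolytope E r s) (PreorderPolytope.homogenizedPolytope E r s) ∧
      PreorderPolytope.IsYTypeGeneralizedPermutohedron
        (PreorderPolytope.homogenizedPolytope E r s) ∧
      PreorderPolytope.rsPolytope E r s =
        {x : E → ℝ | (∀ e, 0 ≤ x e) ∧
          ∀ I : Finset E, IsLowerSet (I : Set E) →
            ∑ e ∈ I, x e ≤ (r : ℝ) * (I.card : ℝ) + (s : ℝ)}) ∧
    PreorderPolytope.rsPolytope E 1 0 = PreorderPolytope.preorderPolytope E :=
  ⟨fun r s => ⟨PreorderPolytope.unimodularlyEquivalent_homogenizedPolytope r s,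
    PreorderPolytope.isYTypeGeneralizedPermutohedron_homogenizedPolytope E r s,
    PreorderPolytope.rsPolytope_eq_setOf r s⟩, PreorderPolytope.rsPolytope_one_zero⟩
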